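/- Let $k$ be an infinite field, $S=k[x_0,\dots,x_n]$ with its standard grading, and let $f_0,\dots,f_r\in S$ be $k$-linearly independent forms of the same degree. Let $I=(f_0,\dots,f_r)\subset S$, let $\phi=(f_0:\dots:f_r):\mathbf P^n\dashrightarrow\mathbf P^r$ be the associated rational map, and let $\ell(I)=1+\dim\operatorname{im}(\phi)$ be the analytic spread of $I$, where $\operatorname{im}(\phi)$ is the closure in $\mathbf P^r$ of $\phi(\mathbf P^n\setminus V(I))$. A homogeneous presentation matrix of a homogeneous ideal $J\subset S$ is the matrix $A$ of a homogeneous free presentation $F\xrightarrow{A}G\to J\to 0$ with $F$, $G$ of finite rank, in which the given basis of $G$ maps to a homogeneous minimal generating set of $J$. A row ideal of $A$ is the ideal generated by the entries of one row of $A$. An ideal is linear if it is generated by linear forms (the zero ideal is linear). Suppose that $I$ has a homogeneous presentation matrix with at least one row ideal that is linear, has codimension at least $\ell(I)-1$, and does not contain $I$. Then for every $d\ge 1$ the power $I^d$ has a homogeneous presentation matrix all of whose row ideals are linear, have codimension exactly $\ell(I)-1$, and do not contain $I$. -/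

import Mathlib

namespace RowIdeals

open MvPolynomial

attribute [local instance] MvPolynomial.gradedAlgebra

/-- The projective space `Proj k[X₀, …, Xₙ]` (all homogeneous primes that do not contain the
irrelevant ideal, with the Zariski topology). -/
abbrev ProjSpace (k : Type*) [Field k] (n : ℕ) : Type _ :=
  ProjectiveSpectrum (homogeneousSubmodule (Fin (n + 1)) k)

section RationalMap

variable {k : Type*} [Field k] {n r : ℕ} (f : Fin (r + 1) → MvPolynomial (Fin (n + 1)) k)

/-- The complement of `V(f₀, …, fᵣ)` in `Pⁿ`, where the rational map `(f₀ : … : fᵣ)` given by forms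
of the same degree is a morphism. -/
def regularLocus : Set (ProjSpace k n) :=
  {x | ¬ Ideal.span (Set.range f) ≤ x.asHomogeneousIdeal.toIdeal}

/-- The rational map `Pⁿ → Pʳ` defined by forms `f₀, …, fᵣ` of the same degree, on points: the point
`x` goes to the homogeneous prime whose homogeneous elements are the forms `F(T₀, …, Tᵣ)` with
`F(f₀, …, fᵣ)` in the prime of `x`.  (If the `fᵢ` have positive degree, the preimage of the prime of
`x` under `Tᵢ ↦ fᵢ` is homogeneous, and so equal to its homogeneous core.) -/
noncomputable def ratMap (x : regularLocus f) : ProjSpace k r where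
  asHomogeneousIdeal :=
    (x.1.asHomogeneousIdeal.toIdeal.comap (aeval f : MvPolynomial (Fin (r + 1)) k →ₐ[k] _)
      ).homogeneousCore (homogeneousSubmodule (Fin (r + 1)) k)
  isPrime := by
    have := x.1.isPrime
    exact Ideal.IsPrime.homogeneousCore (Ideal.comap_isPrime _ _)
  not_irrelevant_le := by
    intro h
    apply x.2
    rw [Ideal.span_le]
    rintro _ ⟨i, rfl⟩
    have h1 : (X i : MvPolynomial (Fin (r + 1)) k) ∈
        (HomogeneousIdeal.irrelevant (homogeneousSubmodule (Fin (r + 1)) k)) := by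
      rw [HomogeneousIdeal.mem_irrelevant_iff, GradedRing.proj_apply,
        DirectSum.decompose_of_mem_ne _ (i := 1) (isHomogeneous_X k i) one_ne_zero]
    have h2 := Ideal.toIdeal_homogeneousCore_le _ _ (h h1)
    simpa using h2

/-- The image of the rational map `(f₀ : … : fᵣ)`, a closed subset of `Pʳ`. -/
noncomputable def ratImage : Set (ProjSpace k r) := closure (Set.range (ratMap f))

/-- The analytic spread of the ideal generated by the forms `f₀, …, fᵣ` of the same degree:
one plus the dimension of the image of the rational map `(f₀ : … : fᵣ)`. -/
noncomputable def analyticSpread : WithBot ℕ∞ := topologicalKrullDim (ratImage f) + 1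

end RationalMap

section Presentation

variable {k : Type*} [Field k] {n s m : ℕ}

/-- `A` is a homogeneous presentation matrix of the ideal `J` with respect to the homogeneous
minimal generating set `g₁, …, gₛ`: there is a homogeneous exact sequence `F → G → J → 0` with
`F = ⊕ S(-eⱼ)` and `G = ⊕ S(-cᵢ)`, where `F → G` is given by `A` and `G → J` by the `gᵢ`. -/
structure IsHomogeneousPresentation (J : Ideal (MvPolynomial (Fin (n + 1)) k))
    (g : Fin s → MvPolynomial (Fin (n + 1)) k)
    (A : Matrix (Fin s) (Fin m) (MvPolynomial (Fin (n + 1)) k)) : Prop where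
  span_eq : Ideal.span (Set.range g) = J
  minimal : ∀ i, Ideal.span (g '' {i}ᶜ) ≠ J
  homogeneous : ∃ (c : Fin s → ℕ) (e : Fin m → ℕ), (∀ i, (g i).IsHomogeneous (c i)) ∧
    ∀ i j, A i j = 0 ∨ ∃ a, a + c i = e j ∧ (A i j).IsHomogeneous a
  exact_seq : Function.Exact A.mulVecLin
    (Fintype.linearCombination (MvPolynomial (Fin (n + 1)) k) g)

/-- The ideal generated by the entries of the `i`-th row of `A`. -/
noncomputable def rowIdeal (A : Matrix (Fin s) (Fin m) (MvPolynomial (Fin (n + 1)) k)) (i : Fin s) :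
    Ideal (MvPolynomial (Fin (n + 1)) k) :=
  Ideal.span (Set.range (A i))

/-- An ideal is linear if it is generated by linear forms. -/
def IsLinear (K : Ideal (MvPolynomial (Fin (n + 1)) k)) : Prop :=
  ∃ L : Set (MvPolynomial (Fin (n + 1)) k), (∀ l ∈ L, l.IsHomogeneous 1) ∧ K = Ideal.span L

end Presentation

end RowIdeals

/-! Let `U` be the `k`-span of the `fⱼ`. For a point `q` off `V(I)`, let `J_q` be the ideal
generated by the members of `U` vanishing at `q`; away from `V(I)` it cuts out the fiber of `φ`
through `q`. The row ideal of a generator `gᵢ` is the colon ideal `(gⱼ : j ≠ i) : gᵢ`. Row ideals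
are thus fiber ideals in disguise when the other generators vanish at a point where `gᵢ` does not.

The given linear row propagates to general points. Each linear form in it extends to a syzygy `∑ⱼ Lⱼ
gⱼ = 0` with linear `Lⱼ`, and then `∑ⱼ gⱼ(q) Lⱼ` multiplies `U` into `J_q` for every `q`. At a
rational zero `q₀` of the row ideal with `gᵢ(q₀) ≠ 0` these forms are the original ones up to a
scalar, so for general `q` they still span a linear prime `P_q` of codimension at least `ℓ - 1`.
Conversely, a minimal prime of `J_q` inside the ideal of `q` contains `P_q` and has height at most
`dim im φ = ℓ - 1`, by the dimension inequality for the affine chart of the image. Hence it equals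
`P_q`, and `J_q ≤ P_q` (`exists_generic_linear_fibers`).

For powers, choose general points `qᵢ` and a basis `Gᵢ` of `U ^ d` dual to evaluation at them
(`exists_basis_dual_to_eval`). The `Gⱼ` with `j ≠ i` lie in `J_{qᵢ}`, while `P_{qᵢ}` multiplies `Gᵢ`
into the ideal they generate. Since `Gᵢ ∉ P_{qᵢ}` and `P_{qᵢ}` is prime, the row ideal of `Gᵢ` is
exactly `P_{qᵢ}` (`rowIdeal_eq_of_dual_to_eval`). -/

namespace RowIdeals

open MvPolynomial

attribute [local instance] MvPolynomial.gradedAlgebra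

/-! ### Fiber codimension is bounded by the dimension of the image -/

section Dimension

variable {k : Type*} [Field k] {n r : ℕ}

/-- An order embedding of a poset into the specialization preorder
yields a lower bound for the topological Krull dimension. -/
theorem le_topologicalKrullDim_of_series {X : Type*} [TopologicalSpace X]
    {α : Type*} [PartialOrder α] (l : LTSeries α) (p : α → X)
    (hp : ∀ a b, a ≤ b → p a ⤳ p b) (hp' : ∀ a b, a ≤ b → p b ⤳ p a → b ≤ a) :
    (l.length : WithBot ℕ∞) ≤ topologicalKrullDim X := by
  -- Specialization shrinks closures, so the chain becomes increasing only in the order dual, which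
  -- has the same Krull dimension.
  let F : α → (TopologicalSpace.IrreducibleCloseds X)ᵒᵈ := fun a ↦ OrderDual.toDual
    ⟨closure {p a}, isIrreducible_singleton.closure, isClosed_closure⟩
  have hle : ∀ a b, p a ⤳ p b ↔ F a ≤ F b := by
    intro a b
    rw [specializes_iff_closure_subset]
    rfl
  have hF : StrictMono F := by
    intro a b hab
    refine lt_of_le_not_ge ((hle a b).1 (hp a b hab.le)) fun h ↦ ?_
    exact absurd (hp' a b hab.le ((hle b a).2 h)) (not_le_of_gt hab)
  rw [topologicalKrullDim, ← Order.krullDim_orderDual]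
  exact Order.LTSeries.length_le_krullDim (l.map F hF)

/-- The homogeneous core of the preimage of a prime `𝔮` under a map `ψ : k[T₀, …, Tᵣ] → R` that
sends some variable to `1`, as a point of projective space. -/
noncomputable def projPoint {R : Type*} [CommRing R] [Algebra k R]
    (ψ : MvPolynomial (Fin (r + 1)) k →ₐ[k] R) (i : Fin (r + 1)) (hi : ψ (X i) = 1)
    (q : PrimeSpectrum R) : ProjSpace k r where
  asHomogeneousIdeal :=
    (q.asIdeal.comap ψ).homogeneousCore (homogeneousSubmodule (Fin (r + 1)) k)
  isPrime := by
    have := q.isPrime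
    exact Ideal.IsPrime.homogeneousCore (Ideal.comap_isPrime _ _)
  not_irrelevant_le := by
    intro h
    have h1 : (X i : MvPolynomial (Fin (r + 1)) k) ∈
        (HomogeneousIdeal.irrelevant (homogeneousSubmodule (Fin (r + 1)) k)) := by
      rw [HomogeneousIdeal.mem_irrelevant_iff, GradedRing.proj_apply,
        DirectSum.decompose_of_mem_ne _ (i := 1) (isHomogeneous_X k i) one_ne_zero]
    have h2 := Ideal.toIdeal_homogeneousCore_le _ _ (h h1)
    rw [Ideal.mem_comap, hi] at h2
    exact q.isPrime.ne_top ((Ideal.eq_top_iff_one _).2 h2)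

/-- Homogenizing with respect to a variable that is sent to `1`. -/
theorem exists_isHomogeneous_map_eq {R : Type*} [CommRing R] [Algebra k R]
    (ψ : MvPolynomial (Fin (r + 1)) k →ₐ[k] R) (i : Fin (r + 1)) (hi : ψ (X i) = 1)
    (G : MvPolynomial (Fin (r + 1)) k) :
    ∃ (F : MvPolynomial (Fin (r + 1)) k) (N : ℕ), F.IsHomogeneous N ∧ ψ F = ψ G := by
  refine ⟨∑ d ∈ Finset.range (G.totalDegree + 1),
    homogeneousComponent d G * X i ^ (G.totalDegree - d), G.totalDegree, ?_, ?_⟩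
  · refine IsHomogeneous.sum _ _ _ fun d hd ↦ ?_
    have hd' : d + 1 * (G.totalDegree - d) = G.totalDegree := by
      have := Finset.mem_range.1 hd
      omega
    have := (homogeneousComponent_isHomogeneous d G).mul
      ((isHomogeneous_X k i).pow (G.totalDegree - d))
    rwa [hd'] at this
  · conv_rhs => rw [← sum_homogeneousComponent G]
    simp [hi]

/-- The homogeneous core loses nothing here: since `X i` maps to `1`, every element of `R` is the
image of a form, so the forms in the preimage determine the prime. -/
theorem projPoint_le_iff {R : Type*} [CommRing R] [Algebra k R]
    (ψ : MvPolynomial (Fin (r + 1)) k →ₐ[k] R) (hψ : Function.Surjective ψ)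
    (i : Fin (r + 1)) (hi : ψ (X i) = 1) (p q : PrimeSpectrum R) :
    projPoint ψ i hi p ≤ projPoint ψ i hi q ↔ p ≤ q := by
  constructor
  · intro h b hb
    obtain ⟨G, rfl⟩ := hψ b
    obtain ⟨F, N, hF, hFG⟩ := exists_isHomogeneous_map_eq ψ i hi G
    rw [← hFG] at hb ⊢
    have h1 : F ∈ (p.asIdeal.comap ψ).homogeneousCore (homogeneousSubmodule (Fin (r + 1)) k) :=
      Ideal.mem_homogeneousCore_of_homogeneous_of_mem ⟨N, hF⟩ hb
    exact Ideal.toIdeal_homogeneousCore_le _ (q.asIdeal.comap ψ) (h h1)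
  · intro h
    exact Ideal.homogeneousCore_mono _ (Ideal.comap_mono h)

/-- A point of `Pʳ` whose prime contains all forms vanishing on `f` lies in the image of the
rational map given by `f`. -/
theorem mem_ratImage (f : Fin (r + 1) → MvPolynomial (Fin (n + 1)) k) (hf : ∃ i, f i ≠ 0)
    (x : ProjSpace k r)
    (hx : ∀ (F : MvPolynomial (Fin (r + 1)) k) (N : ℕ), F.IsHomogeneous N → aeval f F = 0 →
      F ∈ x.asHomogeneousIdeal) : x ∈ ratImage f := by
  -- The generic point of `Pⁿ`: its image is the prime of all forms vanishing on `f`, and the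
  -- closure of that single point already contains `x`.
  let z : ProjSpace k n :=
    { asHomogeneousIdeal := ⊥
      isPrime := by
        rw [HomogeneousIdeal.toIdeal_bot]
        exact Ideal.isPrime_bot
      not_irrelevant_le := by
        intro h
        have h1 : (X 0 : MvPolynomial (Fin (n + 1)) k) ∈
            (HomogeneousIdeal.irrelevant (homogeneousSubmodule (Fin (n + 1)) k)) := by
          rw [HomogeneousIdeal.mem_irrelevant_iff, GradedRing.proj_apply,
            DirectSum.decompose_of_mem_ne _ (i := 1) (isHomogeneous_X k _) one_ne_zero]
        have h2 : (X 0 : MvPolynomial (Fin (n + 1)) k) ∈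
          (⊥ : HomogeneousIdeal (homogeneousSubmodule (Fin (n + 1)) k)).toIdeal := h h1
        rw [HomogeneousIdeal.toIdeal_bot, Ideal.mem_bot] at h2
        exact X_ne_zero _ h2 }
  have hz : z ∈ regularLocus f := by
    intro h
    obtain ⟨i, hi⟩ := hf
    have h2 : f i ∈ (⊥ : HomogeneousIdeal (homogeneousSubmodule (Fin (n + 1)) k)).toIdeal :=
      h (Ideal.subset_span ⟨i, rfl⟩)
    rw [HomogeneousIdeal.toIdeal_bot, Ideal.mem_bot] at h2
    exact hi h2
  have hle : ratMap f ⟨z, hz⟩ ≤ x := by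
    change Ideal.homogeneousCore' _ _ ≤ _
    rw [Ideal.homogeneousCore', Ideal.span_le]
    rintro _ ⟨⟨F, N, hF⟩, hF2, rfl⟩
    refine hx F N hF ?_
    have h2 : aeval f F ∈ (⊥ : HomogeneousIdeal (homogeneousSubmodule (Fin (n + 1)) k)).toIdeal :=
      hF2
    rwa [HomogeneousIdeal.toIdeal_bot, Ideal.mem_bot] at h2
  exact closure_mono (Set.singleton_subset_iff.2 (Set.mem_range_self _))
    ((ProjectiveSpectrum.le_iff_mem_closure _ _ _).1 hle)

/-- The heights of the primes of a `k`-algebra generated by the quotients `fⱼ / fᵢ` are bounded by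
the dimension of the image of the rational map. -/
theorem height_le_topologicalKrullDim_ratImage
    (f : Fin (r + 1) → MvPolynomial (Fin (n + 1)) k) (hf : ∃ i, f i ≠ 0)
    {R : Type*} [CommRing R] [IsNoetherianRing R] [Algebra k R]
    (ψ : MvPolynomial (Fin (r + 1)) k →ₐ[k] R) (hψ : Function.Surjective ψ)
    (i : Fin (r + 1)) (hi : ψ (X i) = 1)
    (hker : ∀ (F : MvPolynomial (Fin (r + 1)) k) (N : ℕ), F.IsHomogeneous N → aeval f F = 0 →
      ψ F = 0) (p : Ideal R) [p.IsPrime] :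
    (p.height : WithBot ℕ∞) ≤ topologicalKrullDim (ratImage f) := by
  obtain ⟨l, -, hl⟩ := p.exists_ltSeries_length_eq_height
  have hmem : ∀ q, projPoint ψ i hi q ∈ ratImage f := by
    intro q
    refine mem_ratImage f hf _ fun F N hF h0 ↦ ?_
    refine Ideal.mem_homogeneousCore_of_homogeneous_of_mem ⟨N, hF⟩ ?_
    rw [Ideal.mem_comap, hker F N hF h0]
    exact Ideal.zero_mem _
  have hsp : ∀ a b, (⟨_, hmem a⟩ : ratImage f) ⤳ ⟨_, hmem b⟩ ↔ a ≤ b := by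
    intro a b
    rw [subtype_specializes_iff, specializes_iff_mem_closure,
      ← ProjectiveSpectrum.le_iff_mem_closure, projPoint_le_iff ψ hψ]
  rw [← hl]
  exact le_topologicalKrullDim_of_series l (fun q ↦ (⟨_, hmem q⟩ : ratImage f))
    (fun a b h ↦ (hsp a b).2 h) (fun a b _ h ↦ (hsp b a).1 h)

/-- The ideal generated by the forms in the linear system `U` that vanish at `q`. -/
noncomputable def vanishingIdealAt (U : Submodule k (MvPolynomial (Fin (n + 1)) k))
    (q : Fin (n + 1) → k) : Ideal (MvPolynomial (Fin (n + 1)) k) :=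
  Ideal.span {u | u ∈ U ∧ eval q u = 0}

/-- The codimension of a component of a fiber of the rational map is at most the dimension of
the image. -/
theorem height_le_of_mem_minimalPrimes_vanishingIdealAt
    (f : Fin (r + 1) → MvPolynomial (Fin (n + 1)) k)
    (q : Fin (n + 1) → k) (Q : Ideal (MvPolynomial (Fin (n + 1)) k))
    (hQ : Q ∈ (vanishingIdealAt (Submodule.span k (Set.range f)) q).minimalPrimes)
    (i : Fin (r + 1)) (hi : eval q (f i) ≠ 0) (hiQ : f i ∉ Q) :
    (Q.height : WithBot ℕ∞) ≤ topologicalKrullDim (ratImage f) := by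
  have hQp : Q.IsPrime := hQ.1.1
  let L := Localization.Away (f i)
  let alg := algebraMap (MvPolynomial (Fin (n + 1)) k) L
  let y : L := IsLocalization.Away.invSelf (f i)
  have hy : alg (f i) * y = 1 := IsLocalization.Away.mul_invSelf (f i)
  -- `Tⱼ ↦ fⱼ / fᵢ`; the range of `ψ` is the coordinate ring of the chart `Tᵢ ≠ 0` of the image.
  let ψ : MvPolynomial (Fin (r + 1)) k →ₐ[k] L := aeval fun j ↦ alg (f j) * y
  have hψ : ∀ (F : MvPolynomial (Fin (r + 1)) k) (N : ℕ), F.IsHomogeneous N →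
      ψ F = alg (aeval f F) * y ^ N := by
    intro F N hF
    have : (∀ c ∈ F.support, c.degree = N) := by
      intro c hc
      have := hF (mem_support_iff.1 hc)
      rw [Finsupp.degree_eq_weight_one]
      exact this
    simp only [ψ, aeval_def, eval₂_eq, map_sum, map_mul, map_prod, map_pow, Finset.sum_mul]
    refine Finset.sum_congr rfl fun c hc ↦ ?_
    simp only [mul_pow, Finset.prod_mul_distrib, Finset.prod_pow_eq_pow_sum]
    rw [← this c hc, Finsupp.degree_apply, mul_assoc]
    congr 1
  have hdisj : Disjoint ((Submonoid.powers (f i) : Set (MvPolynomial (Fin (n + 1)) k))) Q := by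
    rw [Set.disjoint_left]
    rintro _ ⟨m, rfl⟩ hm
    exact hiQ (hQp.mem_of_pow_mem _ hm)
  let QL := Q.map alg
  have hQL : QL.IsPrime := IsLocalization.isPrime_of_isPrime_disjoint (Submonoid.powers (f i)) L Q
    hQp hdisj
  have hQLh : QL.height = Q.height :=
    IsLocalization.height_map_of_disjoint (Submonoid.powers (f i)) Q hdisj
  let R := ψ.range
  have : IsNoetherianRing R := isNoetherianRing_of_surjective _ _ ψ.rangeRestrict.toRingHom
    ψ.rangeRestrict_surjective
  have hLn : IsNoetherianRing L :=
    IsLocalization.isNoetherianRing (Submonoid.powers (f i)) L inferInstance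
  let p : Ideal R := QL.under R
  have hp : p.IsPrime := inferInstance
  -- The contraction `p` contains every `u / fᵢ` with `u` in the linear system and `u(q) = 0`. A
  -- prime over the extension of `p` therefore contains the fiber ideal, and minimality of `Q`
  -- applies.
  have hmin : QL ∈ (p.map (algebraMap R L)).minimalPrimes := by
    refine ⟨⟨hQL, Ideal.map_comap_le⟩, fun P ⟨hP, hPp⟩ hPQ ↦ ?_⟩
    refine Ideal.map_le_iff_le_comap.2 (hQ.2 ⟨Ideal.comap_isPrime _ _, ?_⟩ ?_)
    · rw [vanishingIdealAt, Ideal.span_le]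
      rintro u ⟨huU, huq⟩
      obtain ⟨c, rfl⟩ := (Submodule.mem_span_range_iff_exists_fun k).1 huU
      have hmem : ψ (∑ j, c j • X j) ∈ P := by
        refine hPp (Ideal.mem_map_of_mem (algebraMap R L) (x := ψ.rangeRestrict (∑ j, c j • X j)) ?_)
        change ψ (∑ j, c j • X j) ∈ QL
        rw [hψ _ 1 (IsHomogeneous.sum _ _ _ fun j _ ↦ by
          rw [smul_eq_C_mul]; exact isHomogeneous_C_mul_X _ _)]
        refine Ideal.mul_mem_right _ _ (Ideal.mem_map_of_mem _ (hQ.1.2 (Ideal.subset_span ?_)))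
        have hsum : aeval f (∑ j, c j • X j : MvPolynomial (Fin (r + 1)) k) = ∑ j, c j • f j := by
          simp
        rw [hsum]
        exact ⟨huU, huq⟩
      rw [hψ _ 1 (IsHomogeneous.sum _ _ _ fun j _ ↦ by
          rw [smul_eq_C_mul]; exact isHomogeneous_C_mul_X _ _)] at hmem
      have := Ideal.mul_mem_right (alg (f i)) P hmem
      rw [pow_one, mul_assoc, mul_comm y, hy, mul_one] at this
      simpa using this
    · refine (Ideal.comap_mono hPQ).trans ?_
      exact (IsLocalization.under_map_of_isPrime_disjoint (Submonoid.powers (f i)) L hQp hdisj).le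
  have hlo : QL.LiesOver p := ⟨rfl⟩
  -- The fiber term in `ht QL ≤ ht p + ht (QL / pL)` vanishes because `QL` is minimal over `pL`.
  have h0 : (QL.map (Ideal.Quotient.mk (p.map (algebraMap R L)))).height = 0 := by
    have := Ideal.isPrime_map_quotientMk_of_isPrime hmin.1.2
    rw [Ideal.height_eq_zero_iff]
    have hsurj := Ideal.Quotient.mk_surjective (I := p.map (algebraMap R L))
    have := Ideal.minimalPrimes_map_of_surjective hsurj (p.map (algebraMap R L))
    rw [Ideal.map_quotient_self, Ideal.mk_ker, sup_idem] at this
    exact this.ge ⟨QL, hmin, rfl⟩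
  have h1 := Ideal.height_le_height_add_of_liesOver p QL
  rw [h0, add_zero, hQLh] at h1
  refine (WithBot.coe_le_coe.2 h1).trans ?_
  refine height_le_topologicalKrullDim_ratImage f ⟨i, fun h ↦ hi (by simp [h])⟩
    ψ.rangeRestrict ψ.rangeRestrict_surjective i ?_ ?_ p
  · apply Subtype.ext
    simpa [ψ] using hy
  · intro F N hF h
    apply Subtype.ext
    change ψ F = 0
    rw [hψ F N hF, h, map_zero, zero_mul]

end Dimension

/-! ### Ideals generated by linear forms -/

section LinearIdeals

variable {k : Type*} [Field k] {n : ℕ}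

/-- The linear form with a given vector of coefficients. -/
noncomputable def linForm (k : Type*) [Field k] (n : ℕ) :
    (Fin (n + 1) → k) →ₗ[k] MvPolynomial (Fin (n + 1)) k :=
  Fintype.linearCombination k X

theorem linForm_apply (w : Fin (n + 1) → k) : linForm k n w = ∑ j, w j • X j := by
  simp [linForm, Fintype.linearCombination_apply]

theorem linForm_single (j : Fin (n + 1)) : linForm k n (Pi.single j 1) = X j := by
  simp [linForm]

theorem isHomogeneous_linForm (w : Fin (n + 1) → k) : (linForm k n w).IsHomogeneous 1 := by
  rw [linForm_apply]
  exact IsHomogeneous.sum _ _ _ fun j _ ↦ by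
    rw [smul_eq_C_mul]; exact isHomogeneous_C_mul_X _ _

theorem exists_linForm_eq {p : MvPolynomial (Fin (n + 1)) k} (hp : p.IsHomogeneous 1) :
    ∃ w, linForm k n w = p := by
  have : p ∈ Submodule.span k (Set.range (X : Fin (n + 1) → MvPolynomial (Fin (n + 1)) k)) := by
    rw [← homogeneousSubmodule_one_eq_span_X]
    exact hp
  obtain ⟨w, hw⟩ := (Submodule.mem_span_range_iff_exists_fun k).1 this
  exact ⟨w, by rw [linForm_apply, hw]⟩

theorem linForm_injective : Function.Injective (linForm k n) :=
  linearIndependent_iff_injective_fintypeLinearCombination.1 (linearIndependent_X _ _)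

theorem ideal_span_linForm_image_span (s : Set (Fin (n + 1) → k)) :
    Ideal.span (linForm k n '' (Submodule.span k s : Set (Fin (n + 1) → k))) =
      Ideal.span (linForm k n '' s) := by
  refine le_antisymm (Ideal.span_le.2 ?_)
    (Ideal.span_mono (Set.image_mono Submodule.subset_span))
  rintro _ ⟨w, hw, rfl⟩
  have h1 : linForm k n w ∈ (Submodule.span k s).map (linForm k n) := ⟨w, hw, rfl⟩
  rw [Submodule.map_span] at h1
  exact Submodule.span_le_restrictScalars k (MvPolynomial (Fin (n + 1)) k) _ h1

/-- An ideal generated by linear forms is the kernel of a linear substitution. -/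
theorem exists_algHom_ker_eq_span_linForm (V : Submodule k (Fin (n + 1) → k)) :
    ∃ φ : MvPolynomial (Fin (n + 1)) k →ₐ[k] MvPolynomial (Fin (n + 1)) k,
      RingHom.ker φ = Ideal.span (linForm k n '' V) ∧ ∀ w, φ (linForm k n w) = 0 → w ∈ V := by
  obtain ⟨p, hp⟩ := V.subtype.exists_leftInverse_of_injective (by simp)
  -- With `p` a projection onto `V`, substitute `id - p`. This kills `V` and is the identity modulo
  -- the ideal of `V`, which gives both inclusions for the kernel.
  let φ : MvPolynomial (Fin (n + 1)) k →ₐ[k] MvPolynomial (Fin (n + 1)) k :=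
    aeval fun j ↦
      linForm k n (Pi.single j 1 - (p (Pi.single j 1) : Fin (n + 1) → k))
  have hφ : ∀ w, φ (linForm k n w) = linForm k n (w - p w) := by
    intro w
    have : φ.toLinearMap ∘ₗ linForm k n = linForm k n ∘ₗ (LinearMap.id - V.subtype ∘ₗ p) := by
      refine LinearMap.pi_ext' fun j ↦ LinearMap.ext_ring ?_
      simp [linForm_single, φ]
    exact LinearMap.congr_fun this w
  refine ⟨φ, le_antisymm ?_ ?_, ?_⟩
  · have hmod : (Ideal.Quotient.mkₐ k (Ideal.span (linForm k n '' V))).comp φ =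
        Ideal.Quotient.mkₐ k _ := by
      refine MvPolynomial.algHom_ext fun j ↦ ?_
      rw [AlgHom.comp_apply, ← linForm_single, hφ, map_sub, map_sub, sub_eq_self]
      exact Ideal.Quotient.eq_zero_iff_mem.2 (Ideal.subset_span ⟨_, (p _).2, rfl⟩)
    intro a ha
    have := DFunLike.congr_fun hmod a
    rw [AlgHom.comp_apply, (RingHom.mem_ker).1 ha, map_zero] at this
    exact Ideal.Quotient.eq_zero_iff_mem.1 this.symm
  · rw [Ideal.span_le]
    rintro _ ⟨w, hw, rfl⟩
    have hpw : p w = ⟨w, hw⟩ := LinearMap.congr_fun hp ⟨w, hw⟩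
    change φ _ = 0
    rw [hφ, hpw, sub_self, map_zero]
  · intro w hw
    rw [hφ] at hw
    have := linForm_injective (hw.trans (map_zero _).symm)
    rw [sub_eq_zero.1 this]
    exact (p w).2

theorem isPrime_span_linForm (V : Submodule k (Fin (n + 1) → k)) :
    (Ideal.span (linForm k n '' V)).IsPrime := by
  obtain ⟨φ, hφ, -⟩ := exists_algHom_ker_eq_span_linForm V
  rw [← hφ]
  exact RingHom.ker_isPrime _

theorem linForm_mem_span_linForm_iff (V : Submodule k (Fin (n + 1) → k)) (w : Fin (n + 1) → k) :
    linForm k n w ∈ Ideal.span (linForm k n '' V) ↔ w ∈ V := by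
  refine ⟨fun h ↦ ?_, fun h ↦ Ideal.subset_span ⟨w, h, rfl⟩⟩
  obtain ⟨φ, hφ, hker⟩ := exists_algHom_ker_eq_span_linForm V
  rw [← hφ] at h
  exact hker w h

/-- Over an infinite field, a polynomial outside an ideal generated by linear forms is nonzero at
some rational zero of the ideal. -/
theorem exists_eval_ne_zero_of_notMem_span_linForm [Infinite k]
    (V : Submodule k (Fin (n + 1) → k)) {p : MvPolynomial (Fin (n + 1)) k}
    (hp : p ∉ Ideal.span (linForm k n '' V)) :
    ∃ q, eval q p ≠ 0 ∧ ∀ a ∈ Ideal.span (linForm k n '' V), eval q a = 0 := by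
  obtain ⟨φ, hφ, -⟩ := exists_algHom_ker_eq_span_linForm V
  rw [← hφ] at hp ⊢
  obtain ⟨a, ha⟩ : ∃ a, eval a (φ p) ≠ 0 := by
    by_contra! h
    exact hp (MvPolynomial.funext (by simpa using h))
  have key : ∀ b, eval (fun j ↦ eval a (φ (X j))) b = eval a (φ b) := by
    intro b
    have : (aeval (fun j ↦ eval a (φ (X j))) : _ →ₐ[k] k) = (aeval a : _ →ₐ[k] k).comp φ := by
      refine MvPolynomial.algHom_ext fun j ↦ ?_
      simp [MvPolynomial.aeval_eq_eval]
    simpa [MvPolynomial.aeval_eq_eval] using DFunLike.congr_fun this b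
  refine ⟨fun j ↦ eval a (φ (X j)), by rwa [key], fun b hb ↦ ?_⟩
  rw [key, (RingHom.mem_ker).1 hb, map_zero]

/-- The initial segments of `w` span a strict flag of subspaces, and the corresponding linear ideals
form a strict chain of primes. -/
theorem le_height_span_linForm {v : ℕ} (w : Fin v → Fin (n + 1) → k)
    (hw : LinearIndependent k w) :
    (v : ℕ∞) ≤ (Ideal.span (Set.range fun a ↦ linForm k n (w a))).height := by
  have key : ∀ m : ℕ, m ≤ v → (m : ℕ∞) ≤ (Ideal.span (linForm k n ''
      (Submodule.span k (w '' {a | a.1 < m}) : Set (Fin (n + 1) → k)))).height := by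
    intro m
    induction m with
    | zero => simp
    | succ m ih =>
      intro hm
      have := isPrime_span_linForm (Submodule.span k (w '' {a | a.1 < m}))
      have := isPrime_span_linForm (Submodule.span k (w '' {a | a.1 < m + 1}))
      have hsub : {a : Fin v | a.1 < m} ⊆ {a | a.1 < m + 1} :=
        fun a (ha : a.1 < m) ↦ Nat.lt_succ_of_lt ha
      refine le_trans ?_ (Ideal.height_add_one_le_of_lt_of_isPrime (lt_of_le_not_ge
        (Ideal.span_mono (Set.image_mono (Submodule.span_mono (Set.image_mono hsub)))) fun h ↦ ?_))
      · push_cast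
        gcongr
        exact ih (by omega)
      · have h1 : linForm k n (w ⟨m, hm⟩) ∈ Ideal.span (linForm k n ''
            (Submodule.span k (w '' {a | a.1 < m + 1}) : Set (Fin (n + 1) → k))) :=
          Ideal.subset_span ⟨_, Submodule.subset_span ⟨⟨m, hm⟩, Nat.lt_succ_self m, rfl⟩, rfl⟩
        have h2 := (linForm_mem_span_linForm_iff _ _).1 (h h1)
        exact hw.notMem_span_image (by simp) h2
  have := key v le_rfl
  rw [ideal_span_linForm_image_span, ← Set.image_comp] at this
  have huniv : {a : Fin v | a.1 < v} = Set.univ := Set.eq_univ_of_forall fun a ↦ a.2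
  rwa [huniv, Set.image_univ] at this

end LinearIdeals

/-! ### Row ideals and homogeneous presentations -/

section Presentations

variable {k : Type*} [Field k] {n s m : ℕ}

/-- The columns generate the syzygies, so the row ideal consists of the `i`-th coordinates of all
syzygies: it is the colon ideal `(gⱼ : j ≠ i) : gᵢ`, independent of the chosen columns. -/
theorem mem_rowIdeal_iff {g : Fin s → MvPolynomial (Fin (n + 1)) k}
    {A : Matrix (Fin s) (Fin m) (MvPolynomial (Fin (n + 1)) k)}
    (hA : Function.Exact A.mulVecLin
      (Fintype.linearCombination (MvPolynomial (Fin (n + 1)) k) g))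
    (i : Fin s) (a : MvPolynomial (Fin (n + 1)) k) :
    a ∈ rowIdeal A i ↔ ∃ b : Fin s → MvPolynomial (Fin (n + 1)) k,
      ∑ j, b j * g j = 0 ∧ b i = a := by
  rw [rowIdeal, Ideal.mem_span_range_iff_exists_fun]
  constructor
  · rintro ⟨c, rfl⟩
    refine ⟨A.mulVec c, ?_, ?_⟩
    · simpa [Fintype.linearCombination_apply] using (hA (A.mulVec c)).2 ⟨c, rfl⟩
    · simp [Matrix.mulVec, dotProduct, mul_comm]
  · rintro ⟨b, hb, rfl⟩
    obtain ⟨c, rfl⟩ := (hA b).1 (by simpa [Fintype.linearCombination_apply] using hb)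
    exact ⟨c, by simp [Matrix.mulVec, dotProduct, mul_comm]⟩

theorem homogeneousComponent_mul_of_isHomogeneous (a : MvPolynomial (Fin (n + 1)) k) {c : ℕ}
    {b : MvPolynomial (Fin (n + 1)) k} (hb : b.IsHomogeneous c) (d : ℕ) :
    homogeneousComponent d (a * b) =
      if c ≤ d then homogeneousComponent (d - c) a * b else 0 := by
  have := DirectSum.coe_decompose_mul_of_right_mem (homogeneousSubmodule (Fin (n + 1)) k)
    (a := a) (b := b) d hb
  simp only [← decomposition.decompose'_apply]
  exact this

theorem homogeneousComponent_add_mul (a : MvPolynomial (Fin (n + 1)) k) {c : ℕ}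
    {b : MvPolynomial (Fin (n + 1)) k} (hb : b.IsHomogeneous c) (d : ℕ) :
    homogeneousComponent (d + c) (a * b) = homogeneousComponent d a * b := by
  rw [homogeneousComponent_mul_of_isHomogeneous a hb, if_pos (Nat.le_add_left _ _),
    Nat.add_sub_cancel]

variable {ι : Type*} [Finite ι] {δ : ℕ}

theorem mem_span_of_mem_ideal_span {f : ι → MvPolynomial (Fin (n + 1)) k}
    (hf : ∀ i, (f i).IsHomogeneous δ) {p : MvPolynomial (Fin (n + 1)) k}
    (hp : p ∈ Ideal.span (Set.range f)) (hpδ : p.IsHomogeneous δ) :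
    p ∈ Submodule.span k (Set.range f) := by
  have := Fintype.ofFinite ι
  obtain ⟨b, hb⟩ := (Ideal.mem_span_range_iff_exists_fun).1 hp
  rw [← homogeneousComponent_eq_self hpδ, ← hb, map_sum]
  refine Submodule.sum_mem _ fun i _ ↦ ?_
  rw [homogeneousComponent_mul_of_isHomogeneous _ (hf i), if_pos le_rfl, Nat.sub_self,
    homogeneousComponent_zero, ← smul_eq_C_mul]
  exact Submodule.smul_mem _ _ (Submodule.subset_span ⟨i, rfl⟩)

theorem eq_zero_of_mem_ideal_span_of_lt {f : ι → MvPolynomial (Fin (n + 1)) k}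
    (hf : ∀ i, (f i).IsHomogeneous δ) {p : MvPolynomial (Fin (n + 1)) k}
    (hp : p ∈ Ideal.span (Set.range f)) {c : ℕ} (hpc : p.IsHomogeneous c) (hc : c < δ) :
    p = 0 := by
  have := Fintype.ofFinite ι
  obtain ⟨b, hb⟩ := (Ideal.mem_span_range_iff_exists_fun).1 hp
  rw [← homogeneousComponent_eq_self hpc, ← hb, map_sum]
  refine Finset.sum_eq_zero fun i _ ↦ ?_
  rw [homogeneousComponent_mul_of_isHomogeneous _ (hf i), if_neg (not_le_of_gt hc)]

/-- A homogeneous minimal generating set of an ideal generated in degree `δ` lies in degree `δ`. -/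
theorem isHomogeneous_of_minimal {f : ι → MvPolynomial (Fin (n + 1)) k}
    (hf : ∀ i, (f i).IsHomogeneous δ) {g : Fin s → MvPolynomial (Fin (n + 1)) k}
    (hspan : Ideal.span (Set.range g) = Ideal.span (Set.range f))
    (hmin : ∀ i, Ideal.span (g '' {i}ᶜ) ≠ Ideal.span (Set.range f))
    {c : Fin s → ℕ} (hc : ∀ i, (g i).IsHomogeneous (c i)) (i : Fin s) :
    (g i).IsHomogeneous δ := by
  have hgmem : ∀ j, g j ∈ Ideal.span (Set.range f) := fun j ↦
    hspan ▸ Ideal.subset_span ⟨j, rfl⟩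
  rcases lt_trichotomy (c i) δ with h | h | h
  · rw [eq_zero_of_mem_ideal_span_of_lt hf (hgmem i) (hc i) h]
    exact isHomogeneous_zero _ _ _
  · exact h ▸ hc i
  -- A generator of degree above `δ` is redundant: it cannot contribute to the degree `δ` part of an
  -- expression for any `f j`.
  · refine absurd (le_antisymm ?_ ?_) (hmin i)
    · rw [Ideal.span_le]
      rintro _ ⟨j, -, rfl⟩
      exact hgmem j
    · rw [Ideal.span_le]
      rintro _ ⟨j, rfl⟩
      have hj : f j ∈ Ideal.span (Set.range g) := hspan ▸ Ideal.subset_span ⟨j, rfl⟩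
      obtain ⟨b, hb⟩ := (Ideal.mem_span_range_iff_exists_fun).1 hj
      rw [SetLike.mem_coe, ← homogeneousComponent_eq_self (hf j), ← hb, map_sum]
      refine Ideal.sum_mem _ fun l _ ↦ ?_
      rw [homogeneousComponent_mul_of_isHomogeneous _ (hc l)]
      split_ifs with hl
      · refine Ideal.mul_mem_left _ _ (Ideal.subset_span ⟨l, ?_, rfl⟩)
        rintro rfl
        omega
      · exact Ideal.zero_mem _

/-- The syzygy module of forms of the same degree has finitely many homogeneous generators. -/
theorem exists_homogeneous_presentation {g : Fin s → MvPolynomial (Fin (n + 1)) k}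
    (hg : ∀ i, (g i).IsHomogeneous δ)
    (hmin : ∀ i, Ideal.span (g '' {i}ᶜ) ≠ Ideal.span (Set.range g)) :
    ∃ (m : ℕ) (A : Matrix (Fin s) (Fin m) (MvPolynomial (Fin (n + 1)) k)),
      IsHomogeneousPresentation (Ideal.span (Set.range g)) g A := by
  let S := MvPolynomial (Fin (n + 1)) k
  let Z : Submodule S (Fin s → S) := LinearMap.ker (Fintype.linearCombination S g)
  have hZ : ∀ b, b ∈ Z ↔ ∑ j, b j * g j = 0 := fun b ↦ by
    simp [Z, Fintype.linearCombination_apply]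
  let H : Set (Fin s → S) := {b | b ∈ Z ∧ ∃ a, ∀ j, (b j).IsHomogeneous a}
  have hH : Submodule.span S H = Z := by
    refine le_antisymm (Submodule.span_le.2 fun b hb ↦ hb.1) fun b hb ↦ ?_
    let N := Finset.univ.sup fun j ↦ (b j).totalDegree
    have hbsum : b = ∑ a ∈ Finset.range (N + 1), fun j ↦ homogeneousComponent a (b j) := by
      funext j
      rw [Finset.sum_apply]
      conv_lhs => rw [← sum_homogeneousComponent (b j)]
      refine Finset.sum_subset (Finset.range_mono ?_) fun a _ ha ↦ ?_
      · exact Nat.succ_le_succ (Finset.le_sup (f := fun j ↦ (b j).totalDegree) (Finset.mem_univ j))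
      · exact homogeneousComponent_eq_zero _ _ (by simpa using ha)
    rw [hbsum]
    refine Submodule.sum_mem _ fun a _ ↦ Submodule.subset_span ⟨(hZ _).2 ?_, a, fun j ↦
      homogeneousComponent_isHomogeneous _ _⟩
    have := congrArg (homogeneousComponent (a + δ)) ((hZ b).1 hb)
    simpa only [map_sum, homogeneousComponent_add_mul _ (hg _), map_zero] using this
  obtain ⟨t, htH, ht⟩ := (Submodule.fg_span_iff_fg_span_finset_subset H).1
    (IsNoetherian.noetherian (Submodule.span S H))
  let e := t.equivFin.symm
  refine ⟨t.card, Matrix.of fun i j ↦ (e j).1 i, rfl, hmin, ?_, ?_⟩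
  · choose a ha using fun j : Fin t.card ↦ (htH (e j).2).2
    exact ⟨fun _ ↦ δ, fun j ↦ a j + δ, hg, fun i j ↦ Or.inr ⟨a j, rfl, ha j i⟩⟩
  · rw [LinearMap.exact_iff, Matrix.range_mulVecLin]
    change Z = _
    rw [← hH, ht]
    congr 1
    ext b
    constructor
    · intro hb
      exact ⟨t.equivFin ⟨b, hb⟩, by ext; simp [Matrix.col, e]⟩
    · rintro ⟨j, rfl⟩
      exact (e j).2

end Presentations

/-! ### From one linear row to general fibers -/

section GenericFibers

variable {k : Type*} [Field k] {n r s : ℕ}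

/-- Vectors of polynomials that specialize at one point to linearly independent vectors do so at
every point of a nonempty open set. -/
theorem exists_ne_zero_forall_linearIndependent {v : ℕ}
    (M : Fin v → Fin (n + 1) → MvPolynomial (Fin (n + 1)) k) (q₀ : Fin (n + 1) → k)
    (hM : LinearIndependent k fun a j ↦ eval q₀ (M a j)) :
    ∃ h : MvPolynomial (Fin (n + 1)) k, h ≠ 0 ∧
      ∀ q, eval q h ≠ 0 → LinearIndependent k fun a j ↦ eval q (M a j) := by
  obtain ⟨l, hl⟩ := (Fintype.linearCombination k fun a j ↦ eval q₀ (M a j))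
    |>.exists_leftInverse_of_injective
      (LinearMap.ker_eq_bot.2 (linearIndependent_iff_injective_fintypeLinearCombination.1 hM))
  -- At `q` the rows of `D` are the images of the vectors `M a` under `l`. Its determinant is `1` at
  -- `q₀`, and wherever it is nonzero the vectors are independent.
  let D : Matrix (Fin v) (Fin v) (MvPolynomial (Fin (n + 1)) k) :=
    Matrix.of fun a b ↦ ∑ j, M a j * C (l (Pi.single j 1) b)
  have hD : ∀ q, (eval q).mapMatrix D = Matrix.of fun a ↦ l fun j ↦ eval q (M a j) := by
    intro q
    ext a b
    have : (fun j ↦ eval q (M a j)) = ∑ j, eval q (M a j) • (Pi.single j 1 : Fin (n + 1) → k) := by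
      simpa using pi_eq_sum_univ' (fun j ↦ eval q (M a j))
    rw [Matrix.of_apply, this]
    simp [D]
  refine ⟨D.det, fun h ↦ ?_, fun q hq ↦ ?_⟩
  · have h1 := congrArg (eval q₀) h
    have h2 : (Matrix.of fun a ↦ l fun j ↦ eval q₀ (M a j)) = (1 : Matrix (Fin v) (Fin v) k) := by
      ext a b
      have := LinearMap.congr_fun hl (Pi.single a 1)
      simp only [LinearMap.comp_apply, Fintype.linearCombination_apply_single, one_smul,
        LinearMap.id_apply] at this
      rw [Matrix.of_apply, this, Matrix.one_apply, Pi.single_apply]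
      simp [eq_comm]
    rw [RingHom.map_det, hD, h2, Matrix.det_one, map_zero] at h1
    exact one_ne_zero h1
  · rw [RingHom.map_det, hD] at hq
    have := Matrix.linearIndependent_rows_of_det_ne_zero hq
    exact LinearIndependent.of_comp l this

/-- A prime `P` that multiplies the linear system into the ideal of the fiber through `q`, and has
at least the codimension of a general fiber, is the ideal of the fiber. -/
theorem vanishingIdealAt_le_of_analyticSpread_le
    (f : Fin (r + 1) → MvPolynomial (Fin (n + 1)) k) (q : Fin (n + 1) → k) (i : Fin (r + 1))
    (hi : eval q (f i) ≠ 0) (P : Ideal (MvPolynomial (Fin (n + 1)) k)) [P.IsPrime]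
    (hP : ∀ a ∈ P, a * f i ∈ vanishingIdealAt (Submodule.span k (Set.range f)) q)
    (hht : analyticSpread f ≤ (P.height : WithBot ℕ∞) + 1) :
    vanishingIdealAt (Submodule.span k (Set.range f)) q ≤ P ∧ (∀ a ∈ P, eval q a = 0) ∧
      (P.height : WithBot ℕ∞) + 1 = analyticSpread f := by
  have hker : (RingHom.ker (eval q)).IsPrime := RingHom.ker_isPrime _
  have hle : vanishingIdealAt (Submodule.span k (Set.range f)) q ≤ RingHom.ker (eval q) :=
    Ideal.span_le.2 fun u hu ↦ hu.2
  obtain ⟨Q, hQ, hQq⟩ := Ideal.exists_minimalPrimes_le hle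
  have hQp : Q.IsPrime := hQ.1.1
  have hiQ : f i ∉ Q := fun h ↦ hi (hQq h)
  have hdim := height_le_of_mem_minimalPrimes_vanishingIdealAt f q Q hQ i hi hiQ
  -- `P · fᵢ` lies in the fiber ideal, hence in `Q`, and `fᵢ ∉ Q` because `Q` vanishes at `q`. The
  -- two height bounds then force `P = Q`.
  have hPQ : P ≤ Q := fun a ha ↦ (hQp.mem_or_mem (hQ.1.2 (hP a ha))).resolve_right hiQ
  have hdim' : (Q.height : WithBot ℕ∞) + 1 ≤ analyticSpread f := by
    rw [analyticSpread]
    gcongr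
  have hQP : Q.height ≤ P.height := by
    have := hdim'.trans hht
    norm_cast at this
    exact (WithTop.add_le_add_iff_right ENat.one_ne_top).1 this
  obtain rfl := Ideal.eq_of_le_of_height_le P hPQ hQP
  refine ⟨hQ.1.2, fun a ha ↦ hQq ha, ?_⟩
  exact le_antisymm (by assumption) hht

/-- A linear row ideal of a presentation matrix of forms of the same degree comes from linear
syzygies. -/
theorem exists_linear_syzygies {δ m : ℕ} {g : Fin s → MvPolynomial (Fin (n + 1)) k}
    (hg : ∀ j, (g j).IsHomogeneous δ)
    {A : Matrix (Fin s) (Fin m) (MvPolynomial (Fin (n + 1)) k)}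
    (hA : Function.Exact A.mulVecLin
      (Fintype.linearCombination (MvPolynomial (Fin (n + 1)) k) g))
    (i : Fin s) (hlin : IsLinear (rowIdeal A i)) :
    ∃ (V : Submodule k (Fin (n + 1) → k)) (v : ℕ) (w : Fin v → Fin (n + 1) → k)
      (β : Fin v → Fin s → Fin (n + 1) → k), rowIdeal A i = Ideal.span (linForm k n '' V) ∧
      (rowIdeal A i).height ≤ v ∧ LinearIndependent k w ∧
      (∀ a, β a i = w a) ∧ ∀ a, ∑ j, linForm k n (β a j) * g j = 0 := by
  obtain ⟨L, hL, hK⟩ := hlin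
  let V : Submodule k (Fin (n + 1) → k) :=
    ((rowIdeal A i).restrictScalars k).comap (linForm k n)
  have hV : rowIdeal A i = Ideal.span (linForm k n '' V) := by
    refine le_antisymm ?_ (Ideal.span_le.2 ?_)
    · rw [hK, Ideal.span_le]
      intro l hl
      obtain ⟨w, rfl⟩ := exists_linForm_eq (hL l hl)
      refine Ideal.subset_span ⟨w, ?_, rfl⟩
      change linForm k n w ∈ rowIdeal A i
      exact hK ▸ Ideal.subset_span hl
    · rintro _ ⟨w, hw, rfl⟩
      exact hw
  let b := Module.finBasis k V
  have hspan : Submodule.span k (Set.range fun a ↦ (b a : Fin (n + 1) → k)) = V := by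
    have := congrArg (Submodule.map V.subtype) b.span_eq
    rwa [Submodule.map_span, ← Set.range_comp, Submodule.map_top, Submodule.range_subtype] at this
  have hsyz : ∀ a, ∃ β : Fin s → Fin (n + 1) → k, β i = b a ∧
      ∑ j, linForm k n (β j) * g j = 0 := by
    intro a
    obtain ⟨c, hc, hci⟩ := (mem_rowIdeal_iff hA i _).1 (b a).2
    -- The degree one part of a syzygy is again a syzygy, since all `g j` have the same degree; its
    -- `i`-th entry was already linear.
    choose β hβ using fun j ↦ exists_linForm_eq (homogeneousComponent_isHomogeneous 1 (c j))
    refine ⟨β, linForm_injective ?_, ?_⟩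
    · rw [hβ, hci]
      exact homogeneousComponent_eq_self (isHomogeneous_linForm _)
    · have := congrArg (homogeneousComponent (1 + δ)) hc
      simpa only [map_sum, homogeneousComponent_add_mul _ (hg _), map_zero, hβ] using this
  choose β hβi hβ using hsyz
  refine ⟨V, _, fun a ↦ b a, β, hV, ?_, ?_, hβi, hβ⟩
  · have hne : rowIdeal A i ≠ ⊤ := hV ▸ (isPrime_span_linForm V).ne_top
    -- Krull's height theorem: the ideal is generated by `v` linear forms.
    refine ((rowIdeal A i).height_le_spanFinrank hne).trans ?_
    have hK' : rowIdeal A i = Ideal.span (Set.range fun a ↦ linForm k n (b a)) := by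
      have := ideal_span_linForm_image_span (Set.range fun a ↦ (b a : Fin (n + 1) → k))
      rw [hspan, ← hV, ← Set.range_comp] at this
      exact this
    rw [hK']
    have h1 := Submodule.spanFinrank_span_le_encard (R := MvPolynomial (Fin (n + 1)) k)
      (Set.range fun a ↦ linForm k n (b a))
    refine h1.trans ?_
    rw [← Set.image_univ]
    refine (Set.encard_image_le _ _).trans ?_
    simp
  · exact b.linearIndependent.map' V.subtype (Submodule.ker_subtype V)

/-- If one row ideal is linear of codimension at least `ℓ - 1` and does not contain `I`, then
the ideals of general fibers are linear of codimension `ℓ - 1`. -/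
theorem exists_generic_linear_fibers [Infinite k] {δ m : ℕ}
    (f : Fin (r + 1) → MvPolynomial (Fin (n + 1)) k)
    {g : Fin s → MvPolynomial (Fin (n + 1)) k} (hg : ∀ j, (g j).IsHomogeneous δ)
    (hgU : ∀ j, g j ∈ Submodule.span k (Set.range f))
    {A : Matrix (Fin s) (Fin m) (MvPolynomial (Fin (n + 1)) k)}
    (hA : Function.Exact A.mulVecLin
      (Fintype.linearCombination (MvPolynomial (Fin (n + 1)) k) g))
    (i : Fin s) (hlin : IsLinear (rowIdeal A i))
    (hht : analyticSpread f ≤ ((rowIdeal A i).height : WithBot ℕ∞) + 1)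
    (hne : ¬ Ideal.span (Set.range g) ≤ rowIdeal A i) :
    ∃ h : MvPolynomial (Fin (n + 1)) k, h ≠ 0 ∧ ∀ q, eval q h ≠ 0 →
      ∀ i, eval q (f i) ≠ 0 → ∃ P : Ideal (MvPolynomial (Fin (n + 1)) k), P.IsPrime ∧
        IsLinear P ∧ (P.height : WithBot ℕ∞) + 1 = analyticSpread f ∧
        vanishingIdealAt (Submodule.span k (Set.range f)) q ≤ P ∧ (∀ a ∈ P, eval q a = 0) ∧
        ∀ a ∈ P, ∀ u ∈ Submodule.span k (Set.range f),
          a * u ∈ vanishingIdealAt (Submodule.span k (Set.range f)) q := by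
  classical
  obtain ⟨V, v, w, β, hV, hv, hw, hβw, hβ⟩ := exists_linear_syzygies hg hA i hlin
  have hgj : ∀ j ≠ i, g j ∈ rowIdeal A i := by
    intro j hj
    refine (mem_rowIdeal_iff hA i _).2 ⟨Pi.single i (g j) - Pi.single j (g i), ?_, ?_⟩
    · simp only [Pi.sub_apply, sub_mul, Finset.sum_sub_distrib, Pi.single_apply, ite_mul, zero_mul,
        Finset.sum_ite_eq', Finset.mem_univ, if_true]
      rw [mul_comm, sub_self]
    · simp [hj.symm]
  have hgi : g i ∉ rowIdeal A i := by
    intro h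
    refine hne (Ideal.span_le.2 ?_)
    rintro _ ⟨j, rfl⟩
    by_cases hj : j = i
    · exact hj ▸ h
    · exact hgj j hj
  obtain ⟨q₀, hq₀, hq₀'⟩ := exists_eval_ne_zero_of_notMem_span_linForm V (hV ▸ hgi)
  rw [← hV] at hq₀'
  -- Coefficient vectors of the linear forms `∑ⱼ gⱼ(q) Lⱼ`, with `q` kept indeterminate. At `q₀`
  -- only the term `j = i` survives.
  let M : Fin v → Fin (n + 1) → MvPolynomial (Fin (n + 1)) k := fun a x ↦ ∑ j, C (β a j x) * g j
  have hM : ∀ q a, (fun x ↦ eval q (M a x)) = ∑ j, eval q (g j) • β a j := by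
    intro q a
    funext x
    simp [M, mul_comm]
  have hM₀ : LinearIndependent k fun a x ↦ eval q₀ (M a x) := by
    have : (fun a x ↦ eval q₀ (M a x)) = fun a ↦ eval q₀ (g i) • w a := by
      funext a
      rw [hM, Finset.sum_eq_single i (fun j _ hj ↦ by rw [hq₀' _ (hgj j hj), zero_smul])
        (fun h ↦ absurd (Finset.mem_univ i) h), hβw]
    rw [this]
    exact hw.units_smul fun _ ↦ Units.mk0 _ hq₀
  obtain ⟨h, h0, hh⟩ := exists_ne_zero_forall_linearIndependent M q₀ hM₀
  refine ⟨h, h0, fun q hq i₀ hi₀ ↦ ?_⟩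
  let wq : Fin v → Fin (n + 1) → k := fun a ↦ ∑ j, eval q (g j) • β a j
  have hwq : LinearIndependent k wq := by
    rw [show wq = fun a x ↦ eval q (M a x) from (funext (hM q)).symm]
    exact hh q hq
  let P : Ideal (MvPolynomial (Fin (n + 1)) k) := Ideal.span (Set.range fun a ↦ linForm k n (wq a))
  have hPprime : P.IsPrime := by
    have := isPrime_span_linForm (Submodule.span k (Set.range wq))
    rwa [ideal_span_linForm_image_span, ← Set.range_comp] at this
  have hPU : ∀ a ∈ P, ∀ u ∈ Submodule.span k (Set.range f),
      a * u ∈ vanishingIdealAt (Submodule.span k (Set.range f)) q := by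
    intro a ha u hu
    induction ha using Submodule.span_induction with
    | zero => simp
    | add x y _ _ hx hy => rw [add_mul]; exact Ideal.add_mem _ hx hy
    | smul c x _ hx => rw [smul_eq_mul, mul_assoc]; exact Ideal.mul_mem_left _ _ hx
    | mem x hx =>
      obtain ⟨a, rfl⟩ := hx
      -- The subtracted terms sum to `u(q)` times the syzygy, which is zero; each bracket is a
      -- member of the linear system vanishing at `q`.
      have : linForm k n (wq a) * u = ∑ j, linForm k n (β a j) *
          (eval q (g j) • u - eval q u • g j) := by
        simp only [mul_sub, Finset.sum_sub_distrib, mul_smul_comm, ← Finset.smul_sum, hβ a,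
          smul_zero, sub_zero, wq, map_sum, map_smul, Finset.sum_mul, smul_mul_assoc]
      rw [this]
      refine Ideal.sum_mem _ fun j _ ↦ Ideal.mul_mem_left _ _ (Ideal.subset_span ⟨?_, ?_⟩)
      · exact Submodule.sub_mem _ (Submodule.smul_mem _ _ hu) (Submodule.smul_mem _ _ (hgU j))
      · simp [smul_eval, mul_comm]
  have hPht : analyticSpread f ≤ (P.height : WithBot ℕ∞) + 1 := by
    refine hht.trans ?_
    gcongr
    exact WithBot.coe_le_coe.2 (hv.trans (le_height_span_linForm wq hwq))
  obtain ⟨h1, h2, h3⟩ := vanishingIdealAt_le_of_analyticSpread_le f q i₀ hi₀ P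
    (fun a ha ↦ hPU a ha _ (Submodule.subset_span ⟨i₀, rfl⟩)) hPht
  refine ⟨P, hPprime, ⟨_, ?_, rfl⟩, h3, h1, h2, hPU⟩
  rintro _ ⟨a, rfl⟩
  exact isHomogeneous_linForm _

end GenericFibers

/-! ### Powers of a linear system and evaluation at general points -/

section Powers

variable {k : Type*} [Field k] {n : ℕ}

/-- A finite-dimensional space of polynomials over an infinite field has a basis dual to the
evaluations at suitable points of a given nonempty open set. -/
theorem exists_basis_dual_to_eval [Infinite k] (W : Submodule k (MvPolynomial (Fin (n + 1)) k))
    [Module.Finite k W] {h : MvPolynomial (Fin (n + 1)) k} (h0 : h ≠ 0) :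
    ∃ (N : ℕ) (q : Fin N → Fin (n + 1) → k) (G : Fin N → MvPolynomial (Fin (n + 1)) k),
      (∀ i, eval (q i) h ≠ 0) ∧ (∀ i, G i ∈ W) ∧ (∀ i, eval (q i) (G i) = 1) ∧
      (∀ i j, i ≠ j → eval (q i) (G j) = 0) ∧ ∀ u ∈ W, u = ∑ i, eval (q i) u • G i := by
  let ev : (Fin (n + 1) → k) → Module.Dual k W := fun q ↦ (aeval q).toLinearMap ∘ₗ W.subtype
  have hev : ∀ q (u : W), ev q u = eval q u.1 := fun q u ↦ by
    simp [ev, MvPolynomial.aeval_eq_eval]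
  have hspan : Submodule.span k (ev '' {q | eval q h ≠ 0}) = ⊤ := by
    -- Otherwise some nonzero `z` in `W` would vanish wherever `h` does not, so `z * h` would vanish
    -- at all rational points, impossible over an infinite field.
    refine Submodule.span_eq_top_of_ne_zero fun z hz ↦ ?_
    have hzh : z.1 * h ≠ 0 := mul_ne_zero (by simpa using hz) h0
    obtain ⟨q, hq⟩ : ∃ q, eval q (z.1 * h) ≠ 0 := by
      by_contra! hall
      exact hzh (MvPolynomial.funext (by simpa using hall))
    rw [map_mul] at hq
    exact ⟨_, ⟨q, right_ne_zero_of_mul hq, rfl⟩, by rw [hev]; exact left_ne_zero_of_mul hq⟩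
  let b₀ := Module.Basis.ofSpan hspan.ge
  have hfin := Module.Finite.finite_basis b₀
  let e := Finite.equivFin
    ((linearIndepOn_empty k id).extend (Set.empty_subset (ev '' {q | eval q h ≠ 0})))
  let b := b₀.reindex e
  have hb : ∀ i, ∃ q, eval q h ≠ 0 ∧ ev q = b i := by
    intro i
    obtain ⟨q, hq, hqi⟩ := Module.Basis.ofSpan_subset hspan.ge ⟨e.symm i, rfl⟩
    exact ⟨q, hq, by rw [hqi, Module.Basis.reindex_apply]⟩
  choose q hq hqb using hb
  -- `b` is a basis of the dual of `W` made of evaluations; reflexivity turns its coordinate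
  -- functionals into elements of `W`.
  let G : Fin _ → W := fun i ↦ (Module.evalEquiv k W).symm (b.coord i)
  have hG : ∀ i j, eval (q i) (G j).1 = if i = j then 1 else 0 := by
    intro i j
    rw [← hev, hqb, Module.apply_evalEquiv_symm_apply, Module.Basis.coord_apply,
      Module.Basis.repr_self, Finsupp.single_apply]
  refine ⟨_, q, fun i ↦ (G i).1, hq, fun i ↦ (G i).2, fun i ↦ by rw [hG, if_pos rfl],
    fun i j hij ↦ by rw [hG, if_neg hij], fun u hu ↦ ?_⟩
  have : (⟨u, hu⟩ : W) = ∑ i, eval (q i) u • G i := by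
    rw [← sub_eq_zero]
    refine (Module.forall_dual_apply_eq_zero_iff k _).1 fun φ ↦ ?_
    have hall : ∀ i, b i (⟨u, hu⟩ - ∑ i, eval (q i) u • G i) = 0 := by
      intro i
      rw [← hqb, hev]
      have : ((⟨u, hu⟩ - ∑ i, eval (q i) u • G i : W) : MvPolynomial (Fin (n + 1)) k) =
          u - ∑ i, eval (q i) u • (G i).1 := by simp
      rw [this, map_sub, map_sum]
      simp only [smul_eval, hG, mul_ite, mul_one, mul_zero, Finset.sum_ite_eq, Finset.mem_univ,
        if_true, sub_self]
    rw [← b.sum_repr φ, LinearMap.sum_apply]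
    exact Finset.sum_eq_zero fun i _ ↦ by rw [LinearMap.smul_apply, hall, smul_zero]
  simpa using congrArg Subtype.val this

/-- Modulo the ideal generated by the members of `U` vanishing at `q`, a member of `U ^ d` is
determined by its value at `q`. -/
theorem mem_vanishingIdealAt_of_mem_pow (U : Submodule k (MvPolynomial (Fin (n + 1)) k))
    (q : Fin (n + 1) → k) {u₀ : MvPolynomial (Fin (n + 1)) k} (hu₀ : u₀ ∈ U)
    (hq : eval q u₀ ≠ 0) {d : ℕ} {u : MvPolynomial (Fin (n + 1)) k} (hu : u ∈ U ^ d)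
    (huq : eval q u = 0) : u ∈ vanishingIdealAt U q := by
  let π := (Ideal.Quotient.mkₐ k (vanishingIdealAt U q))
  have hπ : ∀ a, π a = 0 ↔ a ∈ vanishingIdealAt U q := fun a ↦ Ideal.Quotient.eq_zero_iff_mem
  -- Modulo the fiber ideal `U` is spanned by `u₀`, hence `U ^ d` by `u₀ ^ d`. Evaluation at `q`
  -- then detects the coefficient.
  have hle : U.map π.toLinearMap ≤ Submodule.span k {π u₀} := by
    rintro _ ⟨a, ha, rfl⟩
    refine Submodule.mem_span_singleton.2 ⟨eval q a / eval q u₀, ?_⟩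
    rw [AlgHom.toLinearMap_apply, ← map_smul, ← sub_eq_zero, ← map_sub, hπ]
    refine Ideal.subset_span ⟨Submodule.sub_mem _ (Submodule.smul_mem _ _ hu₀) ha, ?_⟩
    simp [smul_eval, hq]
  have h1 : π u ∈ Submodule.span k {π u₀} ^ d := by
    refine pow_le_pow_left' hle d ?_
    rw [← Submodule.map_pow]
    exact ⟨u, hu, rfl⟩
  rw [Submodule.span_pow, Set.singleton_pow, Submodule.mem_span_singleton] at h1
  obtain ⟨c, hc⟩ := h1
  have h2 : c • u₀ ^ d - u ∈ vanishingIdealAt U q := by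
    rw [← hπ, map_sub, map_smul, map_pow, hc, sub_self]
  have h3 : eval q (c • u₀ ^ d - u) = 0 := by
    have : vanishingIdealAt U q ≤ RingHom.ker (eval q) := Ideal.span_le.2 fun a ha ↦ ha.2
    exact this h2
  have hc0 : c = 0 := by
    simpa [smul_eval, huq, hq] using h3
  simpa [hc0] using h2

/-- In a product of `d` factors, `a` moves one factor into the fiber ideal of `U`; the other `d - 1`
factors carry its generators into members of `U ^ d` vanishing at `q`. For `d = 0` no factor is
available and the target ideal is zero. -/
theorem mul_mem_vanishingIdealAt_pow (U : Submodule k (MvPolynomial (Fin (n + 1)) k))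
    (q : Fin (n + 1) → k) {a : MvPolynomial (Fin (n + 1)) k}
    (ha : ∀ u ∈ U, a * u ∈ vanishingIdealAt U q) {d : ℕ} (hd : 1 ≤ d)
    {u : MvPolynomial (Fin (n + 1)) k} (hu : u ∈ U ^ d) : a * u ∈ vanishingIdealAt (U ^ d) q := by
  obtain ⟨d, rfl⟩ := Nat.exists_eq_add_of_le' hd
  rw [pow_succ] at hu
  induction hu using Submodule.mul_induction_on' with
  | add x _ y _ hx hy => rw [mul_add]; exact Ideal.add_mem _ hx hy
  | mem_mul_mem x hx y hy =>
    have hle : vanishingIdealAt U q ≤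
        Submodule.comap
        (LinearMap.mulLeft (MvPolynomial (Fin (n + 1)) k) x) (vanishingIdealAt (U ^ (d + 1)) q) := by
      refine Ideal.span_le.2 fun z hz ↦ Ideal.subset_span ⟨?_, ?_⟩
      · rw [pow_succ]
        exact Submodule.mul_mem_mul hx hz.1
      · simp [hz.2]
    have := hle (ha y hy)
    rw [Submodule.mem_comap, LinearMap.mulLeft_apply] at this
    rwa [mul_left_comm]

theorem ideal_span_pow_eq (U : Submodule k (MvPolynomial (Fin (n + 1)) k)) (d : ℕ) :
    Ideal.span ((U ^ d : Submodule k _) : Set (MvPolynomial (Fin (n + 1)) k)) =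
      Ideal.span (U : Set (MvPolynomial (Fin (n + 1)) k)) ^ d := by
  have key : ∀ W : Submodule k (MvPolynomial (Fin (n + 1)) k), ∀ s, Submodule.span k s = W →
      Ideal.span (W : Set (MvPolynomial (Fin (n + 1)) k)) = Ideal.span s := by
    rintro _ s rfl
    exact le_antisymm (Ideal.span_le.2 (Submodule.span_le_restrictScalars k _ _))
      (Ideal.span_mono Submodule.subset_span)
  rw [Ideal.span, Ideal.span, Submodule.span_pow]
  apply key
  rw [← Submodule.span_pow, Submodule.span_eq]

end Powers

/-! ### Row ideals of powers are ideals of fibers -/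

section RowIdealsOfPowers

variable {k : Type*} [Field k] {n : ℕ}

theorem isHomogeneous_of_mem_pow {U : Submodule k (MvPolynomial (Fin (n + 1)) k)} {δ : ℕ}
    (hU : U ≤ homogeneousSubmodule (Fin (n + 1)) k δ) (d : ℕ)
    {u : MvPolynomial (Fin (n + 1)) k} (hu : u ∈ U ^ d) : u.IsHomogeneous (d * δ) := by
  suffices h : U ^ d ≤ homogeneousSubmodule (Fin (n + 1)) k (d * δ) from h hu
  clear hu
  induction d with
  | zero =>
    rw [pow_zero, zero_mul, Submodule.one_le]
    exact isHomogeneous_one _ _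
  | succ d ih =>
    rw [pow_succ, add_mul, one_mul]
    exact (mul_le_mul' ih hU).trans (homogeneousSubmodule_mul _ _)

/-- The row ideal of a member `G i` of a basis of `U ^ d` dual to evaluations at points is the
ideal `P` of the fiber through the corresponding point. -/
theorem rowIdeal_eq_of_dual_to_eval {N m d : ℕ} (hd : 1 ≤ d)
    (U : Submodule k (MvPolynomial (Fin (n + 1)) k))
    {q : Fin N → Fin (n + 1) → k} {G : Fin N → MvPolynomial (Fin (n + 1)) k}
    (hGU : ∀ i, G i ∈ U ^ d) (hG1 : ∀ i, eval (q i) (G i) = 1)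
    (hG0 : ∀ i j, i ≠ j → eval (q i) (G j) = 0)
    (hGsum : ∀ u ∈ U ^ d, u = ∑ i, eval (q i) u • G i)
    {A : Matrix (Fin N) (Fin m) (MvPolynomial (Fin (n + 1)) k)}
    (hA : Function.Exact A.mulVecLin
      (Fintype.linearCombination (MvPolynomial (Fin (n + 1)) k) G))
    (i : Fin N) {u₀ : MvPolynomial (Fin (n + 1)) k} (hu₀ : u₀ ∈ U) (hqu₀ : eval (q i) u₀ ≠ 0)
    {P : Ideal (MvPolynomial (Fin (n + 1)) k)} (hP : P.IsPrime)
    (hUP : vanishingIdealAt U (q i) ≤ P) (hPq : ∀ a ∈ P, eval (q i) a = 0)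
    (hPU : ∀ a ∈ P, ∀ u ∈ U, a * u ∈ vanishingIdealAt U (q i)) :
    rowIdeal A i = P := by
  classical
  ext a
  rw [mem_rowIdeal_iff hA]
  constructor
  · rintro ⟨b, hb, rfl⟩
    rw [← Finset.add_sum_erase _ _ (Finset.mem_univ i)] at hb
    -- Every other `G j` vanishes at `q i`, hence lies in the fiber ideal and in `P`. Primality
    -- finishes because `G i` is `1` at `q i`.
    have hmem : b i * G i ∈ P := by
      rw [eq_neg_of_add_eq_zero_left hb]
      refine P.neg_mem (P.sum_mem fun j hj ↦ P.mul_mem_left _ (hUP ?_))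
      exact mem_vanishingIdealAt_of_mem_pow U (q i) hu₀ hqu₀ (hGU j)
        (hG0 i j (Finset.ne_of_mem_erase hj).symm)
    refine (hP.mem_or_mem hmem).resolve_right fun h ↦ ?_
    exact one_ne_zero ((hG1 i).symm.trans (hPq _ h))
  · intro ha
    have h1 := mul_mem_vanishingIdealAt_pow U (q i) (hPU a ha) hd (hGU i)
    -- By duality, a member of `U ^ d` vanishing at `q i` has no `G i` component. Replacing `G i` by
    -- `0` keeps the index set `Fin N`.
    have hle : vanishingIdealAt (U ^ d) (q i) ≤
        Ideal.span (Set.range (Function.update G i 0)) := by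
      refine Ideal.span_le.2 fun u ⟨hu, huq⟩ ↦ ?_
      rw [hGsum u hu]
      refine Ideal.sum_mem _ fun j _ ↦ ?_
      by_cases hj : j = i
      · rw [hj, huq, zero_smul]
        exact Ideal.zero_mem _
      · rw [smul_eq_C_mul]
        exact Ideal.mul_mem_left _ _ (Ideal.subset_span ⟨j, Function.update_of_ne hj _ _⟩)
    obtain ⟨c, hc⟩ := (Ideal.mem_span_range_iff_exists_fun).1 (hle h1)
    refine ⟨fun j ↦ if j = i then a else -c j, ?_, if_pos rfl⟩
    have hterm : ∀ j, (if j = i then a else -c j) * G j =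
        (if j = i then a * G i else 0) - c j * Function.update G i 0 j := by
      intro j
      by_cases hj : j = i
      · subst hj
        simp
      · simp [hj]
    rw [Finset.sum_congr rfl fun j _ ↦ hterm j, Finset.sum_sub_distrib, hc]
    simp

end RowIdealsOfPowers

end RowIdeals

/-! ### The main theorem -/

open MvPolynomial RowIdeals in
theorem mainTheorem1 {k : Type*} [Field k] [Infinite k] {n r δ : ℕ}
    (f : Fin (r + 1) → MvPolynomial (Fin (n + 1)) k)
    (hdeg : ∀ i, (f i).IsHomogeneous δ) (hind : LinearIndependent k f)
    (I : Ideal (MvPolynomial (Fin (n + 1)) k)) (hI : I = Ideal.span (Set.range f))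
    (hrow : ∃ (s m : ℕ) (g : Fin s → MvPolynomial (Fin (n + 1)) k)
      (A : Matrix (Fin s) (Fin m) (MvPolynomial (Fin (n + 1)) k)),
      RowIdeals.IsHomogeneousPresentation I g A ∧
      ∃ i, RowIdeals.IsLinear (RowIdeals.rowIdeal A i) ∧
        RowIdeals.analyticSpread f ≤ ((RowIdeals.rowIdeal A i).height : WithBot ℕ∞) + 1 ∧
        ¬ I ≤ RowIdeals.rowIdeal A i)
    (d : ℕ) (hd : 1 ≤ d) :
    ∃ (s m : ℕ) (g : Fin s → MvPolynomial (Fin (n + 1)) k)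
      (A : Matrix (Fin s) (Fin m) (MvPolynomial (Fin (n + 1)) k)),
      RowIdeals.IsHomogeneousPresentation (I ^ d) g A ∧
      ∀ i, RowIdeals.IsLinear (RowIdeals.rowIdeal A i) ∧
        ((RowIdeals.rowIdeal A i).height : WithBot ℕ∞) + 1 = RowIdeals.analyticSpread f ∧
        ¬ I ≤ RowIdeals.rowIdeal A i := by
  subst hI
  obtain ⟨s, m, g, A, hA, i, hlin, hht, hne⟩ := hrow
  obtain ⟨c, -, hc, -⟩ := hA.homogeneous
  have hg := isHomogeneous_of_minimal hdeg hA.span_eq hA.minimal hc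
  have hgU : ∀ j, g j ∈ Submodule.span k (Set.range f) := fun j ↦
    mem_span_of_mem_ideal_span hdeg (hA.span_eq ▸ Ideal.subset_span ⟨j, rfl⟩) (hg j)
  obtain ⟨h, h0, hh⟩ := exists_generic_linear_fibers f hg hgU hA.exact_seq i hlin hht
    (hA.span_eq ▸ hne)
  set U := Submodule.span k (Set.range f) with hU
  have hf0 : f 0 ∈ U := Submodule.subset_span ⟨0, rfl⟩
  have hfin : Module.Finite k ↥(U ^ d) :=
    Module.Finite.iff_fg.2 ((Submodule.fg_span (Set.finite_range f)).pow d)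
  -- The factor `h` makes the fibers through the points linear; the factor `f 0` keeps the points
  -- off `V(I)` and at the end shows that `I` is not contained in any row ideal.
  obtain ⟨N, q, G, hq, hGU, hG1, hG0, hGsum⟩ :=
    exists_basis_dual_to_eval (U ^ d) (mul_ne_zero h0 (hind.ne_zero 0))
  simp only [map_mul] at hq
  choose P hPprime hPlin hPht hUP hPq hPU using fun i ↦
    hh (q i) (left_ne_zero_of_mul (hq i)) 0 (right_ne_zero_of_mul (hq i))
  have hspan : Ideal.span (Set.range G) = Ideal.span (Set.range f) ^ d := by
    have hfU : Ideal.span (U : Set (MvPolynomial (Fin (n + 1)) k)) = Ideal.span (Set.range f) :=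
      Submodule.span_span_of_tower k _ _
    rw [← hfU, ← ideal_span_pow_eq]
    refine le_antisymm (Ideal.span_mono ?_) (Ideal.span_le.2 fun u hu ↦ ?_)
    · rintro _ ⟨j, rfl⟩
      exact hGU j
    · rw [SetLike.mem_coe, hGsum u hu]
      refine Ideal.sum_mem _ fun j _ ↦ ?_
      rw [smul_eq_C_mul]
      exact Ideal.mul_mem_left _ _ (Ideal.subset_span ⟨j, rfl⟩)
  have hmin : ∀ i, Ideal.span (G '' {i}ᶜ) ≠ Ideal.span (Set.range G) := by
    intro i hi
    -- Minimality is read off at the dual point: all other generators vanish at `q i`, while `G i`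
    -- does not.
    have hle : Ideal.span (G '' {i}ᶜ) ≤ RingHom.ker (eval (q i)) := by
      rw [Ideal.span_le]
      rintro _ ⟨j, hj, rfl⟩
      exact hG0 i j (Ne.symm hj)
    have hGi : G i ∈ Ideal.span (G '' {i}ᶜ) := hi ▸ Ideal.subset_span ⟨i, rfl⟩
    exact one_ne_zero ((hG1 i).symm.trans (hle hGi))
  have hUδ : U ≤ homogeneousSubmodule (Fin (n + 1)) k δ := by
    rw [hU, Submodule.span_le]
    rintro _ ⟨j, rfl⟩
    exact hdeg j
  obtain ⟨m', B, hB⟩ := exists_homogeneous_presentation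
    (fun j ↦ isHomogeneous_of_mem_pow hUδ d (hGU j)) hmin
  refine ⟨N, m', G, B, hspan ▸ hB, fun i ↦ ?_⟩
  rw [rowIdeal_eq_of_dual_to_eval hd U hGU hG1 hG0 hGsum hB.exact_seq i hf0
    (right_ne_zero_of_mul (hq i)) (hPprime i) (hUP i) (hPq i) (hPU i)]
  refine ⟨hPlin i, hPht i, fun hle ↦ ?_⟩
  exact right_ne_zero_of_mul (hq i) (hPq i _ (hle (Ideal.subset_span ⟨0, rfl⟩)))
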